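/- For $\varepsilon>0$ with $2\pi\varepsilon^2\le 1$, $\delta>0$ and real $\eta$ with $|\eta|<1-\delta$, put $$k=\frac{\sqrt2}{\delta}\,\log^{1/2}\frac{1}{2\pi\varepsilon^2},\qquad R=\frac{\sqrt{1-|\eta|}}{\delta}\ (>1),\qquad \operatorname{erf}(x)=\frac{2}{\sqrt\pi}\int_0^x e^{-t^2}\,dt .$$ Then the shifted error function $f(x)=\operatorname{erf}(k(x-\eta))$ can be approximated to error $\varepsilon$ on $[-1,1]$ by a polynomial that is bounded by $1$ in absolute value on $[-1,1]$ and has degree $O\big(R\,\log R\,\log^{3/2}\frac1\varepsilon\big)$, uniformly in $\varepsilon,\delta,\eta$ as long as $R$ stays bounded away from $1$. Precisely: for every $r>1$ there is a constant $C>0$, depending only on $r$, such that for all $\varepsilon,\delta,\eta$ as above with $R\ge r$ there is a real polynomial $p$ with $$|f(x)-p(x)|\le\varepsilon\quad\text{and}\quad |p(x)|\le 1\qquad\text{for all }x\in[-1,1],$$ $$\deg p\le C\,\frac{\sqrt{1-|\eta|}}{\delta}\,\log\Big(\frac{\sqrt{1-|\eta|}}{\delta}\Big)\,\log^{3/2}\frac1\varepsilon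 .$$ (Since $R>\delta^{-1/2}$, the condition $R\ge r$ holds for instance whenever $\delta\le r^{-2}$.) -/

import Mathlib

/-- The (real) error function `erf x = (2 / √π) ∫₀ˣ exp (-t ^ 2) dt`. -/
noncomputable def erf (x : ℝ) : ℝ :=
  2 / Real.sqrt Real.pi * ∫ t in (0 : ℝ)..x, Real.exp (-t ^ 2)

/-- The steepness `k = (√2 / δ) log^{1/2} (1 / (2 π ε ^ 2))` attached to an error `ε`
and a width `δ`. -/
noncomputable def steepness (ε δ : ℝ) : ℝ :=
  Real.sqrt 2 / δ * Real.sqrt (Real.log (1 / (2 * Real.pi * ε ^ 2)))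

/-! The function `erf (k (x - η))` is entire, so its Chebyshev coefficients decay like `ρ⁻ⁿ` times
its maximum on the Bernstein ellipse of parameter `ρ`
(`exists_polynomial_approx_of_bernsteinEllipse`). Take `ρ = exp (1 / R)`: above `η` the ellipse has
height about `√(1 - η²) / R`, which is `O(δ)`. Elsewhere the squared height grows only linearly in
the distance to `η`, so the term `-(Re z - η)²` absorbs it. Hence the maximum is at most `10 k exp
(41 (k δ)²)` (`norm_complexErf_bernsteinEllipse_le`), and since `(k δ)² ≤ 4 log (1/ε)` this is `k`
times a fixed power of `1/ε`.

A degree of order `R (log (1/ε) + log R)` therefore suffices (`truncation_error_le`). The bound of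
the theorem is weaker, and `degree_budget` passes to it. Approximating to `ε / 2` and then rescaling
makes the polynomial bounded by one. -/

/-! ### The error function on the complex plane. -/

/-- The entire extension of the error function, as an integral along the segment `[0, z]`. -/
noncomputable def complexErf (z : ℂ) : ℂ :=
  (2 / Real.sqrt Real.pi : ℝ) * ∫ t in (0 : ℝ)..1, z * Complex.exp (-((t : ℂ) * z) ^ 2)

theorem differentiable_complexErf : Differentiable ℂ complexErf := by
  intro z₀
  unfold complexErf
  refine DifferentiableAt.const_mul ?_ _
  set F' : ℂ → ℝ → ℂ := fun z t =>
    Complex.exp (-((t : ℂ) * z) ^ 2) * (1 - 2 * (t : ℂ) ^ 2 * z ^ 2) with hF'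
  have hcont : Continuous (fun q : ℂ × ℝ => F' q.1 q.2) := by
    simp only [hF']; fun_prop
  obtain ⟨B, hB⟩ := ((isCompact_closedBall z₀ 1).prod (isCompact_Icc (a := (0 : ℝ))
    (b := 1))).exists_bound_of_continuousOn hcont.continuousOn
  refine ((intervalIntegral.hasDerivAt_integral_of_dominated_loc_of_deriv_le
    (μ := MeasureTheory.volume) (F := fun z (t : ℝ) => z * Complex.exp (-((t : ℂ) * z) ^ 2))
    (F' := F') (s := Metric.closedBall z₀ 1) (bound := fun _ => B)
    (Metric.closedBall_mem_nhds _ one_pos) ?_ ?_ ?_ ?_ ?_ ?_).2).differentiableAt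
  · exact Filter.Eventually.of_forall fun z =>
      (by fun_prop : Continuous fun t : ℝ =>
        z * Complex.exp (-((t : ℂ) * z) ^ 2)).aestronglyMeasurable
  · exact (by fun_prop : Continuous fun t : ℝ =>
      z₀ * Complex.exp (-((t : ℂ) * z₀) ^ 2)).intervalIntegrable _ _
  · exact (by simp only [hF']; fun_prop : Continuous fun t : ℝ => F' z₀ t).aestronglyMeasurable
  · refine Filter.Eventually.of_forall fun t ht z hz => hB (z, t) ⟨hz, ?_⟩
    rw [Set.uIoc_of_le zero_le_one] at ht
    exact ⟨ht.1.le, ht.2⟩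
  · exact intervalIntegrable_const
  · refine Filter.Eventually.of_forall fun t _ z _ => ?_
    have h := (hasDerivAt_id z).mul
      ((((hasDerivAt_id z).const_mul (t : ℂ)).pow 2).neg.cexp)
    refine h.congr_deriv ?_
    simp only [hF', id, Pi.neg_apply, Pi.pow_apply]
    push_cast
    ring

theorem complexErf_ofReal (x : ℝ) : complexErf x = (erf x : ℂ) := by
  unfold complexErf erf
  have h : ∫ t in (0 : ℝ)..x, Real.exp (-t ^ 2) = ∫ t in (0 : ℝ)..1, x * Real.exp (-(t * x) ^ 2) := by
    rw [intervalIntegral.integral_const_mul]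
    have := intervalIntegral.mul_integral_comp_mul_right (a := 0) (b := 1)
      (f := fun t => Real.exp (-t ^ 2)) x
    simpa using this.symm
  rw [h, Complex.ofReal_mul, ← intervalIntegral.integral_ofReal]
  push_cast
  rfl

/-- At the point `t z` of the segment the integrand has modulus `‖z‖ exp (t² (Im² z - Re² z))`.
Since `t² ≤ 1`, the exponent is at most `B`; `0 ≤ B` is needed because `t` may be near `0`. -/
theorem norm_complexErf_le {z : ℂ} {B : ℝ} (hB : 0 ≤ B) (h : z.im ^ 2 - z.re ^ 2 ≤ B) :
    ‖complexErf z‖ ≤ 2 * ‖z‖ * Real.exp B := by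
  have hc : 2 / Real.sqrt Real.pi ≤ 2 :=
    div_le_self zero_le_two (Real.one_le_sqrt.2 (by linarith [Real.pi_gt_three]))
  have hi : ‖∫ t in (0 : ℝ)..1, z * Complex.exp (-((t : ℂ) * z) ^ 2)‖
      ≤ ‖z‖ * Real.exp B * |(1 : ℝ) - 0| := by
    refine intervalIntegral.norm_integral_le_of_norm_le_const fun t ht => ?_
    rw [Set.uIoc_of_le zero_le_one] at ht
    rw [norm_mul, Complex.norm_exp]
    gcongr
    have : (-((t : ℂ) * z) ^ 2).re = t ^ 2 * (z.im ^ 2 - z.re ^ 2) := by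
      simp [sq]; ring
    rw [this]
    have ht2 : t ^ 2 ≤ 1 := pow_le_one₀ ht.1.le ht.2
    nlinarith [sq_nonneg t]
  unfold complexErf
  rw [norm_mul, Complex.norm_real, Real.norm_of_nonneg (by positivity)]
  simp only [sub_zero, abs_one, mul_one] at hi
  calc _ ≤ 2 * (‖z‖ * Real.exp B) := by gcongr
    _ = _ := by ring

theorem abs_erf_le_one (x : ℝ) : |erf x| ≤ 1 := by
  have hint : MeasureTheory.Integrable (fun t : ℝ => Real.exp (-t ^ 2)) := by
    simpa using integrable_exp_neg_mul_sq (b := 1) one_pos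
  have hI : ∫ t in Set.Ioi (0 : ℝ), Real.exp (-t ^ 2) = Real.sqrt Real.pi / 2 := by
    simpa using integral_gaussian_Ioi 1
  have key : ∀ y : ℝ, 0 ≤ y → |∫ t in (0 : ℝ)..y, Real.exp (-t ^ 2)| ≤ Real.sqrt Real.pi / 2 := by
    intro y hy
    rw [intervalIntegral.integral_of_le hy, abs_of_nonneg
      (MeasureTheory.integral_nonneg fun t => (Real.exp_pos _).le), ← hI]
    exact MeasureTheory.setIntegral_mono_set hint.integrableOn
      (Filter.Eventually.of_forall fun t => (Real.exp_pos _).le)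
      (Filter.Eventually.of_forall fun t ht => ht.1)
  have key' : |∫ t in (0 : ℝ)..x, Real.exp (-t ^ 2)| ≤ Real.sqrt Real.pi / 2 := by
    rcases le_total 0 x with hx | hx
    · exact key x hx
    · have h := intervalIntegral.integral_comp_neg (a := 0) (b := x)
        (fun t : ℝ => Real.exp (-t ^ 2))
      simp only [neg_sq, neg_zero] at h
      rw [h, intervalIntegral.integral_symm, abs_neg]
      exact key _ (neg_nonneg.2 hx)
  unfold erf
  have hp : 0 < Real.sqrt Real.pi := Real.sqrt_pos.2 Real.pi_pos
  rw [abs_mul, abs_of_pos (by positivity)]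
  calc _ ≤ 2 / Real.sqrt Real.pi * (Real.sqrt Real.pi / 2) := by gcongr
    _ = 1 := by field_simp

/-! ### Chebyshev truncation for entire functions, through Fourier series of `θ ↦ g (cos θ)`. -/

section Chebyshev
open Complex

/-- The Joukowski map, sending the circle of radius `ρ` to a Bernstein ellipse. -/
noncomputable def joukowski (w : ℂ) : ℂ := (w + w⁻¹) / 2

theorem joukowski_exp (z : ℂ) : joukowski (exp (z * I)) = cos z := by
  rw [joukowski, Complex.cos, ← exp_neg, neg_mul]

instance fact_two_pi_pos : Fact (0 < 2 * Real.pi) := ⟨Real.two_pi_pos⟩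

/-- The function `θ ↦ g (cos θ)` on the circle. -/
noncomputable def cosPullback (g : ℂ → ℂ) (hg : Continuous g) : C(AddCircle (2 * Real.pi), ℂ) where
  toFun x := g (joukowski (AddCircle.toCircle x))
  continuous_toFun := by
    refine hg.comp ?_
    unfold joukowski
    have h : Continuous fun x : AddCircle (2 * Real.pi) => (AddCircle.toCircle x : ℂ) :=
      continuous_induced_dom.comp AddCircle.continuous_toCircle
    exact (h.add (h.inv₀ fun x => Circle.coe_ne_zero _)).div_const 2

theorem cosPullback_coe (g : ℂ → ℂ) (hg : Continuous g) (θ : ℝ) :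
    cosPullback g hg (θ : AddCircle (2 * Real.pi)) = g (cos θ) := by
  change g (joukowski (AddCircle.toCircle (θ : AddCircle (2 * Real.pi)))) = _
  rw [AddCircle.toCircle_apply_mk, div_self Real.two_pi_pos.ne', one_mul, Circle.coe_exp,
    joukowski_exp]

theorem fourierCoeff_cosPullback (g : ℂ → ℂ) (hg : Continuous g) (n : ℤ) :
    fourierCoeff (cosPullback g hg) n =
      (2 * Real.pi * I : ℂ)⁻¹ • ∮ w in C(0, 1), g (joukowski w) * w ^ (-n - 1) := by
  rw [fourierCoeff_eq_intervalIntegral _ _ 0, circleIntegral, zero_add, real_smul, smul_eq_mul,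
    ← intervalIntegral.integral_const_mul, ← intervalIntegral.integral_const_mul]
  refine intervalIntegral.integral_congr fun θ _ => ?_
  have hpi : (Real.pi : ℂ) ≠ 0 := by exact_mod_cast Real.pi_ne_zero
  simp only [cosPullback_coe, fourier_coe_apply, deriv_circleMap, circleMap_zero, smul_eq_mul,
    ofReal_one, one_mul, joukowski_exp]
  rw [zpow_sub_one₀ (exp_ne_zero _), ← exp_int_mul]
  have h : (2 * Real.pi * I * ((-n : ℤ) : ℂ) * θ / ((2 * Real.pi : ℝ) : ℂ)) =
      ((-n : ℤ) : ℂ) * (θ * I) := by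
    push_cast; field_simp
  rw [h]
  have := exp_ne_zero (θ * I)
  push_cast
  field_simp [I_ne_zero]

theorem circleIntegral_joukowski_eq (g : ℂ → ℂ) (hg : Differentiable ℂ g) (n : ℤ) {a b : ℝ}
    (ha : 0 < a) (hab : a ≤ b) :
    (∮ w in C(0, b), g (joukowski w) * w ^ n) = ∮ w in C(0, a), g (joukowski w) * w ^ n := by
  have hd : ∀ w : ℂ, w ≠ 0 → DifferentiableAt ℂ (fun w => g (joukowski w) * w ^ n) w := by
    intro w hw
    refine DifferentiableAt.mul (hg.differentiableAt.comp w ?_)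
      (differentiableAt_zpow.2 (Or.inl hw))
    unfold joukowski
    exact (differentiableAt_id.add (differentiableAt_inv hw)).div_const 2
  refine circleIntegral_eq_of_differentiable_on_annulus_off_countable ha hab
    Set.countable_empty ?_ ?_
  · intro w hw
    refine (hd w ?_).continuousAt.continuousWithinAt
    rintro rfl
    exact hw.2 (Metric.mem_ball_self ha)
  · intro w hw
    refine hd w ?_
    rintro rfl
    exact hw.1.2 (Metric.mem_closedBall_self ha.le)

theorem joukowski_inv (w : ℂ) : joukowski w⁻¹ = joukowski w := by
  rw [joukowski, joukowski, inv_inv, add_comm]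

/-- The coefficient is a contour integral whose integrand is holomorphic away from `0`. For `n ≥ 0`
the unit circle is pushed out to radius `ρ`, for `n ≤ 0` in to `ρ⁻¹`; by `joukowski_inv` both
circles map to the same ellipse, so `M` serves for both. -/
theorem norm_fourierCoeff_cosPullback_le (g : ℂ → ℂ) (hg : Differentiable ℂ g) {ρ M : ℝ}
    (hρ : 1 < ρ) (hM : ∀ w : ℂ, ‖w‖ = ρ → ‖g (joukowski w)‖ ≤ M) (n : ℤ) :
    ‖fourierCoeff (cosPullback g hg.continuous) n‖ ≤ M * (ρ⁻¹) ^ n.natAbs := by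
  have hρ0 : 0 < ρ := one_pos.trans hρ
  rw [fourierCoeff_cosPullback]
  obtain ⟨m, rfl | rfl⟩ := n.eq_nat_or_neg
  · rw [← circleIntegral_joukowski_eq g hg _ one_pos hρ.le]
    refine (circleIntegral.norm_two_pi_i_inv_smul_integral_le_of_norm_le_const
      (C := M * ρ ^ (-(m : ℤ) - 1)) hρ0.le ?_).trans_eq ?_
    · intro w hw
      have hw' : ‖w‖ = ρ := by simpa using hw
      rw [norm_mul, norm_zpow, hw']
      gcongr
      exact hM w hw'
    · rw [zpow_sub_one₀ hρ0.ne', Int.natAbs_natCast, inv_pow, zpow_neg, zpow_natCast]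
      field_simp
  · rw [circleIntegral_joukowski_eq g hg _ (inv_pos.2 hρ0) (inv_le_one_of_one_le₀ hρ.le)]
    refine (circleIntegral.norm_two_pi_i_inv_smul_integral_le_of_norm_le_const
      (C := M * (ρ⁻¹) ^ ((m : ℤ) - 1)) (inv_pos.2 hρ0).le ?_).trans_eq ?_
    · intro w hw
      have hw' : ‖w‖ = ρ⁻¹ := by simpa using hw
      rw [norm_mul, norm_zpow, hw', neg_neg]
      gcongr
      rw [← joukowski_inv]
      exact hM _ (by rw [norm_inv, hw', inv_inv])
    · rw [zpow_sub_one₀ (inv_pos.2 hρ0).ne', Int.natAbs_neg, Int.natAbs_natCast, zpow_natCast]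
      field_simp

theorem summable_pow_natAbs {q : ℝ} (h0 : 0 ≤ q) (h1 : q < 1) :
    Summable fun n : ℤ => q ^ n.natAbs := by
  refine Summable.of_nat_of_neg ?_ ?_ <;>
    simpa using summable_geometric_of_lt_one h0 h1

theorem hasSum_pow_natAbs_tail {q : ℝ} (h0 : 0 ≤ q) (h1 : q < 1) (N : ℕ) :
    HasSum (fun n : ℤ => if n ∈ Finset.Icc (-(N : ℤ)) N then 0 else q ^ n.natAbs)
      (2 * q ^ (N + 1) / (1 - q)) := by
  have hgeom : HasSum (fun n : ℕ => q ^ (n + (N + 1))) (q ^ (N + 1) / (1 - q)) := by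
    simpa [pow_add, div_eq_mul_inv, mul_comm] using
      (hasSum_geometric_of_lt_one h0 h1).mul_right (q ^ (N + 1))
  have hpos : HasSum (fun n : ℕ =>
      if (n : ℤ) ∈ Finset.Icc (-(N : ℤ)) N then 0 else q ^ (n : ℤ).natAbs)
      (q ^ (N + 1) / (1 - q)) := by
    rw [← hasSum_nat_add_iff' (N + 1), Finset.sum_eq_zero, sub_zero]
    · refine hgeom.congr_fun fun n => ?_
      rw [if_neg (by rw [Finset.mem_Icc]; omega), Int.natAbs_natCast]
    · intro n hn
      rw [Finset.mem_range] at hn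
      rw [if_pos (by rw [Finset.mem_Icc]; omega)]
  have hneg : HasSum (fun n : ℕ =>
      if (-((n : ℤ) + 1)) ∈ Finset.Icc (-(N : ℤ)) N then 0 else q ^ (-((n : ℤ) + 1)).natAbs)
      (q ^ (N + 1) / (1 - q)) := by
    -- Negative integers are indexed as `-(n + 1)`, so `N` terms lie in the window here, against `N
    -- + 1` on the nonnegative side.
    rw [← hasSum_nat_add_iff' N, Finset.sum_eq_zero, sub_zero]
    · refine hgeom.congr_fun fun n => ?_
      rw [if_neg (by rw [Finset.mem_Icc]; omega)]
      congr 1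
    · intro n hn
      rw [Finset.mem_range] at hn
      rw [if_pos (by rw [Finset.mem_Icc]; omega)]
  have h := HasSum.of_nat_of_neg_add_one
    (f := fun n : ℤ => if n ∈ Finset.Icc (-(N : ℤ)) N then 0 else q ^ n.natAbs) hpos hneg
  rwa [← add_div, ← two_mul] at h

open Polynomial in
/-- An entire function bounded by `M` on the Bernstein ellipse of parameter `ρ` is approximated on
`[-1, 1]` by its truncated Chebyshev expansion at a geometric rate. -/
theorem exists_polynomial_approx_of_bernsteinEllipse (g : ℂ → ℂ) (hg : Differentiable ℂ g)
    {ρ M : ℝ} (hρ : 1 < ρ) (hM : ∀ w : ℂ, ‖w‖ = ρ → ‖g (joukowski w)‖ ≤ M) (N : ℕ) :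
    ∃ p : ℝ[X], p.natDegree ≤ N ∧ ∀ x ∈ Set.Icc (-1 : ℝ) 1,
      |(g x).re - p.eval x| ≤ 2 * M * (ρ⁻¹) ^ (N + 1) / (1 - ρ⁻¹) := by
  have hρ0 : 0 < ρ := one_pos.trans hρ
  have hq0 : 0 ≤ ρ⁻¹ := (inv_pos.2 hρ0).le
  have hq1 : ρ⁻¹ < 1 := inv_lt_one_of_one_lt₀ hρ
  set a : ℤ → ℂ := fourierCoeff (cosPullback g hg.continuous) with ha
  have hbd : ∀ n, ‖a n‖ ≤ M * (ρ⁻¹) ^ n.natAbs := norm_fourierCoeff_cosPullback_le g hg hρ hM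
  have hmaj : Summable fun n : ℤ => M * (ρ⁻¹) ^ n.natAbs :=
    (summable_pow_natAbs hq0 hq1).mul_left M
  have hsum : Summable a := Summable.of_norm_bounded hmaj hbd
  have hseries : ∀ θ : ℝ, HasSum (fun n : ℤ => (a n).re * Real.cos (n * θ)) (g (cos θ)).re := by
    intro θ
    have h : ∀ θ : ℝ, HasSum (fun n : ℤ => a n * exp (n * θ * I)) (g (cos θ)) := by
      intro θ
      have := has_pointwise_sum_fourier_series_of_summable hsum (θ : AddCircle (2 * Real.pi))
      rw [cosPullback_coe] at this
      convert! this using 2 with n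
      rw [smul_eq_mul, fourier_coe_apply]
      congr 2
      have hpi : (Real.pi : ℂ) ≠ 0 := by exact_mod_cast Real.pi_ne_zero
      push_cast
      field_simp
    have h1 := h θ
    have h2 := h (-θ)
    rw [ofReal_neg, cos_neg] at h2
    -- Averaging the series at `θ` and `-θ` leaves only cosines, as `cos` is even.
    have h3 := (h1.add h2).mul_left (1 / 2)
    have h4 := hasSum_re h3
    have h5 : 1 / 2 * (g (cos θ) + g (cos θ)) = g (cos θ) := by ring
    rw [h5] at h4
    convert! h4 using 2 with n
    have h6 : 1 / 2 * (a n * exp (n * θ * I) + a n * exp (n * (-θ) * I)) =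
        a n * (Real.cos (n * θ) : ℝ) := by
      push_cast
      rw [Complex.cos]
      ring_nf
    rw [h6, re_mul_ofReal]
  -- The sum runs over negative indices too, where `T₋ₙ = Tₙ`; this replaces the usual factor `2` on
  -- the terms with `n > 0`.
  refine ⟨∑ n ∈ Finset.Icc (-(N : ℤ)) N, C (a n).re * Chebyshev.T ℝ n, ?_, ?_⟩
  · refine natDegree_sum_le_of_forall_le _ _ fun n hn => ?_
    refine (natDegree_C_mul_le _ _).trans ?_
    rw [Finset.mem_Icc] at hn
    rw [Chebyshev.natDegree_T]
    omega
  · intro x hx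
    obtain ⟨θ, rfl⟩ : ∃ θ, Real.cos θ = x := ⟨Real.arccos x, Real.cos_arccos hx.1 hx.2⟩
    set s : Finset ℤ := Finset.Icc (-(N : ℤ)) N with hs
    have hdiff : HasSum (fun n : ℤ => if n ∈ s then 0 else (a n).re * Real.cos (n * θ))
        ((g (Real.cos θ : ℝ)).re - (∑ n ∈ s, C (a n).re * Chebyshev.T ℝ n).eval (Real.cos θ)) := by
      have h1 : HasSum (fun n : ℤ => if n ∈ s then (a n).re * Real.cos (n * θ) else 0)
          ((∑ n ∈ s, C (a n).re * Chebyshev.T ℝ n).eval (Real.cos θ)) := by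
        have h := hasSum_sum_of_ne_finset_zero (L := .unconditional ℤ) (s := s)
          (f := fun n : ℤ => if n ∈ s then (a n).re * Real.cos (n * θ) else 0)
          fun n hn => if_neg hn
        convert! h using 1
        rw [eval_finsetSum]
        refine Finset.sum_congr rfl fun n hn => ?_
        rw [if_pos hn, eval_mul, eval_C, Chebyshev.T_real_cos]
      have h2 := (hseries θ).sub h1
      rw [ofReal_cos]
      convert! h2 using 2 with n
      split_ifs <;> simp
    have htail := (hasSum_pow_natAbs_tail hq0 hq1 N).mul_left M
    refine (hdiff.norm_le_of_bounded htail fun n => ?_).trans_eq (by ring)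
    split_ifs with h
    · simp
    · rw [norm_mul, Real.norm_eq_abs, Real.norm_eq_abs]
      calc _ ≤ ‖a n‖ * 1 := by
            gcongr
            · exact abs_re_le_norm _
            · exact Real.abs_cos_le_one _
        _ ≤ _ := by rw [mul_one]; exact hbd n

end Chebyshev

/-! ### Size of the shifted error function on the Bernstein ellipse. -/

section ErrorFunction
open Complex

theorem steepness_nonneg_and_sq_le {ε δ : ℝ} (hε : 0 < ε) (hε1 : 2 * Real.pi * ε ^ 2 ≤ 1) (hδ : 0 < δ) :
    0 ≤ steepness ε δ ∧ (steepness ε δ * δ) ^ 2 ≤ 4 * Real.log (1 / ε) := by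
  have hpi := Real.pi_gt_three
  have hlog : 0 ≤ Real.log (1 / (2 * Real.pi * ε ^ 2)) :=
    Real.log_nonneg ((one_le_div (by positivity)).2 hε1)
  refine ⟨by unfold steepness; positivity, ?_⟩
  have h : (steepness ε δ * δ) ^ 2 = 2 * Real.log (1 / (2 * Real.pi * ε ^ 2)) := by
    unfold steepness
    field_simp
    rw [Real.sq_sqrt hlog, Real.sq_sqrt zero_le_two]
  have h2 : Real.log (1 / (2 * Real.pi * ε ^ 2)) ≤ 2 * Real.log (1 / ε) := by
    rw [← Real.log_rpow (by positivity), Real.rpow_two]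
    refine Real.log_le_log (by positivity) ?_
    rw [div_pow, one_pow]
    refine one_div_le_one_div_of_le (by positivity) ?_
    nlinarith [sq_nonneg ε]
  linarith

/-- Since `2 π > e`, the hypothesis forces `1 / ε² ≥ e`. -/
theorem half_le_log_inv {ε : ℝ} (hε : 0 < ε) (hε1 : 2 * Real.pi * ε ^ 2 ≤ 1) :
    1 / 2 ≤ Real.log (1 / ε) := by
  have hpi := Real.pi_gt_three
  have he := Real.exp_one_lt_d9
  have h2 : 1 ≤ 2 * Real.log (1 / ε) := by
    rw [← Real.log_rpow (by positivity), Real.rpow_two, Real.le_log_iff_exp_le (by positivity),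
      div_pow, one_pow, le_div_iff₀ (by positivity)]
    nlinarith [sq_nonneg ε]
  linarith

theorem sinh_sq_le {s : ℝ} (hs0 : 0 ≤ s) (hs1 : s ≤ 1) : Real.sinh s ^ 2 ≤ 4 * s ^ 2 := by
  have h1 := Real.abs_exp_sub_one_le (x := s) (by rwa [abs_of_nonneg hs0])
  have h2 := Real.abs_exp_sub_one_le (x := -s) (by rwa [abs_neg, abs_of_nonneg hs0])
  rw [abs_neg] at h2
  rw [abs_of_nonneg hs0, abs_le] at h1 h2
  rw [Real.sinh_eq]
  nlinarith [Real.exp_le_exp.2 (show -s ≤ s by linarith)]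

theorem cosh_sub_one_le {s : ℝ} (hs0 : 0 ≤ s) (hs1 : s ≤ 1) : Real.cosh s - 1 ≤ s ^ 2 := by
  have h1 := Real.abs_exp_sub_one_sub_id_le (x := s) (by rwa [abs_of_nonneg hs0])
  have h2 := Real.abs_exp_sub_one_sub_id_le (x := -s) (by rwa [abs_neg, abs_of_nonneg hs0])
  rw [abs_le] at h1 h2
  rw [Real.cosh_eq]
  linarith [h1.2, h2.2]

/-- With `θ = arg w`, `w = exp (i (θ - i s))`, so its Joukowski image is `cos (θ - i s)`. -/
theorem exists_joukowski_coords {s : ℝ} {w : ℂ} (hw : ‖w‖ = Real.exp s) :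
    ∃ θ : ℝ, (joukowski w).re = Real.cos θ * Real.cosh s ∧
      (joukowski w).im = Real.sin θ * Real.sinh s := by
  refine ⟨w.arg, ?_⟩
  have h : w = exp ((w.arg - s * I) * I) := by
    conv_lhs => rw [← norm_mul_exp_arg_mul_I w, hw, ofReal_exp, ← exp_add]
    congr 1
    linear_combination (s : ℂ) * I_sq
  have hj : joukowski w = cos (w.arg - s * I) := by
    conv_lhs => rw [h]
    exact joukowski_exp _
  have h' : joukowski w = ((Real.cos w.arg * Real.cosh s : ℝ) : ℂ) +
      ((Real.sin w.arg * Real.sinh s : ℝ) : ℂ) * I := by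
    rw [hj, cos_sub, cos_mul_I, sin_mul_I]
    push_cast
    ring
  rw [h']
  exact ⟨by rw [add_re, ofReal_re, re_ofReal_mul, I_re, mul_zero, add_zero],
    by rw [add_im, ofReal_im, im_ofReal_mul, I_im, mul_one, zero_add]⟩

/-- On the Bernstein ellipse of parameter `exp s` with `s ^ 2 (1 - |η|) = δ ^ 2`, the region where
`exp (-(z - η) ^ 2)` is large is only `O(δ)` wide. -/
theorem bernsteinEllipse_im_sq_sub_re_sq_le {s δ η : ℝ} (hs0 : 0 ≤ s) (hs1 : s ≤ 1)
    (hδ : 0 < δ) (hη : |η| < 1 - δ) (hsδ : s ^ 2 * (1 - |η|) = δ ^ 2) {w : ℂ}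
    (hw : ‖w‖ = Real.exp s) :
    (joukowski w).im ^ 2 - ((joukowski w).re - η) ^ 2 ≤ 41 * δ ^ 2 ∧
      ‖joukowski w - η‖ ≤ 5 := by
  obtain ⟨θ, hre, him⟩ := exists_joukowski_coords hw
  set c := Real.cos θ
  have hc : |c| ≤ 1 := Real.abs_cos_le_one θ
  have hsin : Real.sin θ ^ 2 = 1 - c ^ 2 := Real.sin_sq θ
  have hch0 : 0 ≤ Real.cosh s - 1 := by linarith [Real.one_le_cosh s]
  have hch := cosh_sub_one_le hs0 hs1
  have hsh := sinh_sq_le hs0 hs1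
  have hη0 := abs_nonneg η
  -- This follows from `hsδ`, because `1 - |η| > δ`.
  have hs2 : s ^ 2 ≤ δ := by
    by_contra! h
    nlinarith
  set d := |c - η| with hd
  have hd0 : 0 ≤ d := abs_nonneg _
  have hy : (joukowski w).im ^ 2 ≤ 8 * δ ^ 2 + 8 * δ * d := by
    -- Split `1 - c² = (1 - η²) + (η² - c²)`; the first part is at most `2 (1 - |η|)`, the second at
    -- most `2 d`.
    have h1 : 1 - c ^ 2 ≤ 2 * (1 - |η|) + 2 * d := by
      have h2 : (η - c) * (η + c) ≤ d * 2 := by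
        calc _ ≤ |η - c| * |η + c| := by rw [← abs_mul]; exact le_abs_self _
          _ ≤ d * 2 := by
            rw [abs_sub_comm]
            gcongr
            linarith [abs_add_le η c]
      nlinarith [sq_abs η, sq_nonneg (1 - |η|)]
    have h0 : 0 ≤ 1 - c ^ 2 := hsin ▸ sq_nonneg _
    calc (joukowski w).im ^ 2 = (1 - c ^ 2) * Real.sinh s ^ 2 := by rw [him, mul_pow, hsin]
      _ ≤ (1 - c ^ 2) * (4 * s ^ 2) := by gcongr
      _ ≤ (2 * (1 - |η|) + 2 * d) * (4 * s ^ 2) := by gcongr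
      _ = 8 * (s ^ 2 * (1 - |η|)) + 8 * s ^ 2 * d := by ring
      _ ≤ _ := by rw [hsδ]; gcongr
  -- Replacing `c` by `c cosh s` moves the real part by at most `cosh s - 1 ≤ s² ≤ δ`.
  have hx : d ≤ |(joukowski w).re - η| + δ := by
    rw [hre]
    have h1 : c - η = (c * Real.cosh s - η) - c * (Real.cosh s - 1) := by ring
    have h2 : |c * (Real.cosh s - 1)| ≤ δ := by
      rw [abs_mul, abs_of_nonneg hch0]
      nlinarith
    have h3 := abs_sub (c * Real.cosh s - η) (c * (Real.cosh s - 1))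
    rw [← h1] at h3
    linarith
  constructor
  -- With `X = |Re - η|`, `hy` and `hx` give `Im² - X² ≤ 16 δ² + 8 δ X - X² ≤ 32 δ²`, so the
  -- constant `41` has slack.
  · rw [← sq_abs ((joukowski w).re - η)]
    nlinarith [sq_nonneg (d - 8 * δ), sq_nonneg (|(joukowski w).re - η| - δ),
      abs_nonneg ((joukowski w).re - η)]
  · have hη1 : |η| ≤ 1 := by linarith
    have h1 : |(joukowski w).re - η| ≤ 3 := by
      rw [hre]
      calc _ ≤ |c * Real.cosh s| + |η| := abs_sub _ _
        _ ≤ 1 * 2 + 1 := by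
          rw [abs_mul, abs_of_nonneg (by linarith : 0 ≤ Real.cosh s)]
          gcongr
          nlinarith
        _ = 3 := by norm_num
    have h2 : |(joukowski w).im| ≤ 2 := by
      refine abs_le_of_sq_le_sq ?_ zero_le_two
      rw [him, mul_pow, hsin]
      nlinarith [sq_nonneg c, sq_nonneg (Real.sinh s)]
    have h3 := norm_le_abs_re_add_abs_im (joukowski w - η)
    simp only [sub_re, sub_im, ofReal_re, ofReal_im, sub_zero] at h3
    linarith

theorem norm_complexErf_bernsteinEllipse_le {k s δ η : ℝ} (hk : 0 ≤ k) (hs0 : 0 ≤ s) (hs1 : s ≤ 1)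
    (hδ : 0 < δ) (hη : |η| < 1 - δ) (hsδ : s ^ 2 * (1 - |η|) = δ ^ 2) {w : ℂ}
    (hw : ‖w‖ = Real.exp s) :
    ‖complexErf (k * (joukowski w - η))‖ ≤ 10 * k * Real.exp (41 * (k * δ) ^ 2) := by
  obtain ⟨h1, h2⟩ := bernsteinEllipse_im_sq_sub_re_sq_le hs0 hs1 hδ hη hsδ hw
  have h3 : ((k : ℂ) * (joukowski w - η)).im ^ 2 - ((k : ℂ) * (joukowski w - η)).re ^ 2 ≤
      41 * (k * δ) ^ 2 := by
    simp only [re_ofReal_mul, im_ofReal_mul, sub_re, sub_im, ofReal_re, ofReal_im, sub_zero]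
    nlinarith [sq_nonneg k]
  refine (norm_complexErf_le (by positivity) h3).trans ?_
  rw [norm_mul, norm_real, Real.norm_of_nonneg hk]
  have : 2 * (k * ‖joukowski w - η‖) ≤ 10 * k := by nlinarith
  gcongr

end ErrorFunction

/-! ### Rescaling the approximant and counting the degree. -/

section Degree

/-- Shrinking an approximation slightly makes it bounded by one. -/
theorem exists_bounded_approx_of_approx {f : ℝ → ℝ} {S : Set ℝ} {ε : ℝ} (hε : 0 < ε)
    (hf : ∀ x ∈ S, |f x| ≤ 1) {q : Polynomial ℝ} (hq : ∀ x ∈ S, |f x - q.eval x| ≤ ε / 2) :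
    ∃ p : Polynomial ℝ, p.natDegree ≤ q.natDegree ∧ (∀ x ∈ S, |f x - p.eval x| ≤ ε) ∧
      ∀ x ∈ S, |p.eval x| ≤ 1 := by
  have hpos : 0 < 1 + ε / 2 := by positivity
  refine ⟨Polynomial.C (1 + ε / 2)⁻¹ * q, Polynomial.natDegree_C_mul_le _ _, ?_, ?_⟩
  · intro x hx
    rw [Polynomial.eval_mul, Polynomial.eval_C]
    have h : f x - (1 + ε / 2)⁻¹ * q.eval x =
        ((f x - q.eval x) + ε / 2 * f x) / (1 + ε / 2) := by
      field_simp
      ring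
    rw [h, abs_div, abs_of_pos hpos, div_le_iff₀ hpos]
    have h1 := abs_add_le (f x - q.eval x) (ε / 2 * f x)
    rw [abs_mul, abs_of_pos (half_pos hε)] at h1
    nlinarith [hf x hx, hq x hx]
  · intro x hx
    rw [Polynomial.eval_mul, Polynomial.eval_C, abs_mul, abs_of_pos (inv_pos.2 hpos),
      inv_mul_le_iff₀ hpos]
    have h1 := abs_sub (f x) (f x - q.eval x)
    rw [sub_sub_cancel] at h1
    linarith [hf x hx, hq x hx]

/-- The degree needed: with `ℓ = log (1 / ε)` and `s = 1 / R`, a polynomial of degree `N` with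
`N / R ≥ 166 ℓ + 3 log R + 5` meets the error `ε / 2`. -/
theorem truncation_error_le {R ℓ k M E : ℝ} {N : ℕ} (hR : 1 < R)
    (hk : k ≤ 2 * Real.exp ℓ * R ^ 2) (hM : M ≤ 10 * k * Real.exp E)
    (hE : E ≤ 164 * ℓ)
    (hN : 166 * ℓ + 3 * Real.log R + 5 ≤ N / R) :
    2 * M * ((Real.exp (1 / R))⁻¹) ^ (N + 1) / (1 - (Real.exp (1 / R))⁻¹) ≤
      Real.exp (-ℓ) / 2 := by
  have hR0 : 0 < R := one_pos.trans hR
  have hs : 0 < 1 / R := by positivity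
  -- The geometric tail costs a factor `R`. Together with the `R²` in the bound for `k` this makes
  -- the `R³` behind `3 log R`.
  have h1 : 1 / R ≤ Real.exp (1 / R) - 1 := by linarith [Real.add_one_le_exp (1 / R)]
  have hexp := Real.exp_pos (1 / R)
  have hform : 2 * M * ((Real.exp (1 / R))⁻¹) ^ (N + 1) / (1 - (Real.exp (1 / R))⁻¹) =
      2 * M * Real.exp (-(N / R)) / (Real.exp (1 / R) - 1) := by
    have h2 : Real.exp (-(N / R)) = ((Real.exp (1 / R))⁻¹) ^ N := by
      rw [← Real.exp_neg, ← Real.exp_nat_mul]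
      congr 1
      ring
    have h3 : Real.exp (1 / R) - 1 ≠ 0 := by linarith
    rw [h2, pow_succ]
    field_simp
  rw [hform]
  -- Here `165 = 164 + 1`, the extra unit coming from the bound on `k`; the target `exp (-ℓ)` raises
  -- it to the `166` of `hN`.
  have hM2 : M ≤ 20 * R ^ 2 * Real.exp (165 * ℓ) := by
    calc M ≤ 10 * (2 * Real.exp ℓ * R ^ 2) * Real.exp (164 * ℓ) := by
          refine hM.trans ?_
          gcongr
      _ = 20 * R ^ 2 * (Real.exp ℓ * Real.exp (164 * ℓ)) := by ring
      _ = _ := by rw [← Real.exp_add]; ring_nf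
  have h80 : (80 : ℝ) ≤ Real.exp 5 := by
    have h := Real.exp_one_gt_d9
    have h5 : Real.exp 5 = Real.exp 1 ^ 5 := by rw [← Real.exp_nat_mul]; norm_num
    rw [h5]
    calc (80 : ℝ) ≤ 2.7 ^ 5 := by norm_num
      _ ≤ _ := by gcongr; linarith
  have hR3 : R ^ 3 = Real.exp (3 * Real.log R) := by
    rw [mul_comm, Real.exp_mul, Real.exp_log hR0]; norm_cast
  calc 2 * M * Real.exp (-(N / R)) / (Real.exp (1 / R) - 1)
      ≤ 2 * (20 * R ^ 2 * Real.exp (165 * ℓ)) * Real.exp (-(N / R)) / (1 / R) := by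
        gcongr
    _ = 80 * (R ^ 3 * Real.exp (165 * ℓ) * Real.exp (-(N / R))) / 2 := by
        field_simp; ring
    _ ≤ Real.exp 5 * (R ^ 3 * Real.exp (165 * ℓ) * Real.exp (-(N / R))) / 2 := by
        gcongr
    _ = Real.exp (5 + (3 * Real.log R + 165 * ℓ + -(N / R))) / 2 := by
        rw [hR3, ← Real.exp_add, ← Real.exp_add, ← Real.exp_add]
    _ ≤ Real.exp (-ℓ) / 2 := by
        gcongr
        linarith

/-- The sum `ℓ + log R` is dominated by the product `ℓ log R` because both factors are bounded
below: `log R ≥ log r` and `ℓ ≥ 1/2`. This is where the constant acquires its dependence on `r`. The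
same bound on `ℓ` gives `ℓ ≤ 2 ℓ^(3/2)`. -/
theorem degree_budget {r R ℓ : ℝ} (hr : 1 < r) (hrR : r ≤ R) (hℓ : 1 / 2 ≤ ℓ) :
    R * (166 * ℓ + 3 * Real.log R + 5) + 1 ≤
      2 * (178 / Real.log r + 6) * (R * Real.log R * ℓ ^ (3 / 2 : ℝ)) := by
  have hlr : 0 < Real.log r := Real.log_pos hr
  have hlR : Real.log r ≤ Real.log R := Real.log_le_log (by linarith) hrR
  have hR : 1 < R := hr.trans_le hrR
  have hℓ0 : 0 < ℓ := by linarith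
  have h32 : ℓ ≤ 2 * ℓ ^ (3 / 2 : ℝ) := by
    have h1 : ℓ ^ (3 / 2 : ℝ) = ℓ * Real.sqrt ℓ := by
      rw [Real.sqrt_eq_rpow]
      nth_rewrite 2 [← Real.rpow_one ℓ]
      rw [← Real.rpow_add hℓ0]
      norm_num
    have h2 : 1 / 2 ≤ Real.sqrt ℓ := Real.le_sqrt_of_sq_le (by linarith)
    rw [h1]
    nlinarith
  have h178 : 178 * ℓ ≤ 178 / Real.log r * Real.log R * ℓ := by
    gcongr
    rw [div_mul_eq_mul_div, le_div_iff₀ hlr]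
    gcongr
  -- The constants merge as `5 R + 1 ≤ 6 R ≤ 12 R ℓ`, whence `178 = 166 + 12`.
  calc R * (166 * ℓ + 3 * Real.log R + 5) + 1
      ≤ R * (178 * ℓ + 6 * (Real.log R * ℓ)) := by
        have : Real.log R ≤ Real.log R * (2 * ℓ) :=
          le_mul_of_one_le_right (by linarith) (by linarith)
        nlinarith
    _ ≤ R * (178 / Real.log r * Real.log R * ℓ + 6 * (Real.log R * ℓ)) := by gcongr
    _ = (178 / Real.log r + 6) * (R * Real.log R * ℓ) := by ring
    _ ≤ (178 / Real.log r + 6) * (R * Real.log R * (2 * ℓ ^ (3 / 2 : ℝ))) := by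
        have : 0 ≤ Real.log R := by linarith
        gcongr
    _ = _ := by ring

end Degree

/-! ### Assembly of the theorem. -/

theorem lemma1 :
    ∀ r : ℝ, 1 < r → ∃ C : ℝ, 0 < C ∧
      ∀ ε δ η : ℝ, 0 < ε → 2 * Real.pi * ε ^ 2 ≤ 1 → 0 < δ → |η| < 1 - δ →
        r ≤ Real.sqrt (1 - |η|) / δ →
        ∃ p : Polynomial ℝ,
          (∀ x ∈ Set.Icc (-1 : ℝ) 1, |erf (steepness ε δ * (x - η)) - p.eval x| ≤ ε) ∧
          (∀ x ∈ Set.Icc (-1 : ℝ) 1, |p.eval x| ≤ 1) ∧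
          (p.natDegree : ℝ) ≤
            C * (Real.sqrt (1 - |η|) / δ * Real.log (Real.sqrt (1 - |η|) / δ) *
              Real.log (1 / ε) ^ (3 / 2 : ℝ)) := by
  intro r hr
  have hlr := Real.log_pos hr
  refine ⟨2 * (178 / Real.log r + 6), by positivity, ?_⟩
  intro ε δ η hε hε1 hδ hη hrR
  set R := Real.sqrt (1 - |η|) / δ with hRdef
  set ℓ := Real.log (1 / ε) with hℓdef
  set k := steepness ε δ with hkdef
  have hℓ : 1 / 2 ≤ ℓ := half_le_log_inv hε hε1
  have hR : 1 < R := hr.trans_le hrR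
  have hR0 : 0 < R := one_pos.trans hR
  obtain ⟨hk0, hk⟩ : 0 ≤ k ∧ (k * δ) ^ 2 ≤ 4 * ℓ := steepness_nonneg_and_sq_le hε hε1 hδ
  have hexpℓ : Real.exp (-ℓ) = ε := by
    rw [hℓdef, one_div, Real.log_inv, neg_neg, Real.exp_log hε]
  have hRsq : R ^ 2 * δ ^ 2 = 1 - |η| := by
    rw [hRdef, div_pow, Real.sq_sqrt (by linarith)]
    field_simp
  -- The choice `s = 1 / R` satisfies the ellipse condition exactly.
  have hsδ : (1 / R) ^ 2 * (1 - |η|) = δ ^ 2 := by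
    rw [← hRsq]; field_simp
  have hkR : k ≤ 2 * Real.exp ℓ * R ^ 2 := by
    -- Since `R² δ² = 1 - |η| > δ`, the factor `1 / δ` in the steepness is at most `R²`.
    have h1 : 1 ≤ R ^ 2 * δ := by
      by_contra! h
      nlinarith
    have h2 : k * δ ≤ 2 * Real.exp ℓ := by
      refine le_of_abs_le (abs_le_of_sq_le_sq ?_ (by positivity))
      nlinarith [Real.add_one_le_exp ℓ]
    calc k ≤ k * (R ^ 2 * δ) := le_mul_of_one_le_right hk0 h1
      _ = (k * δ) * R ^ 2 := by ring
      _ ≤ _ := by gcongr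
  have hdiff : Differentiable ℂ fun z : ℂ => complexErf (k * (z - η)) :=
    differentiable_complexErf.comp ((differentiable_id.sub_const _).const_mul _)
  have hs1 : 1 / R ≤ 1 := by rw [div_le_one hR0]; exact hR.le
  obtain ⟨q, hqdeg, hq⟩ := exists_polynomial_approx_of_bernsteinEllipse
    (fun z : ℂ => complexErf (k * (z - η))) hdiff
    (Real.one_lt_exp_iff.2 (by positivity : 0 < 1 / R))
    (fun w hw => norm_complexErf_bernsteinEllipse_le hk0 (by positivity) hs1 hδ hη hsδ hw)
    ⌈R * (166 * ℓ + 3 * Real.log R + 5)⌉₊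
  have hlogR := Real.log_nonneg hR.le
  have herr := truncation_error_le (N := ⌈R * (166 * ℓ + 3 * Real.log R + 5)⌉₊) hR
    hkR le_rfl (by linarith : 41 * (k * δ) ^ 2 ≤ 164 * ℓ)
    (by rw [le_div_iff₀ hR0, mul_comm]; exact Nat.le_ceil _)
  have happrox : ∀ x ∈ Set.Icc (-1 : ℝ) 1, |erf (k * (x - η)) - q.eval x| ≤ ε / 2 := by
    intro x hx
    have h := (hq x hx).trans herr
    rw [hexpℓ] at h
    have h2 : (k : ℂ) * (x - η) = ((k * (x - η) : ℝ) : ℂ) := by push_cast; ring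
    simpa only [h2, complexErf_ofReal, Complex.ofReal_re] using h
  obtain ⟨p, hpdeg, hp1, hp2⟩ := exists_bounded_approx_of_approx hε
    (fun x _ => abs_erf_le_one _) happrox
  refine ⟨p, hp1, hp2, ?_⟩
  calc (p.natDegree : ℝ) ≤ (⌈R * (166 * ℓ + 3 * Real.log R + 5)⌉₊ : ℝ) := by
        exact_mod_cast hpdeg.trans hqdeg
    _ ≤ R * (166 * ℓ + 3 * Real.log R + 5) + 1 := (Nat.ceil_lt_add_one (by positivity)).le
    _ ≤ _ := degree_budget hr hrR hℓ
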